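/- Let $\Phi$ and $\Psi$ be independent homogeneous Poisson point processes in $\mathbb{R}^2$ with intensities $1$ and $\lambda>0$, respectively. For $x\in\mathbb{R}^2$ and $s\ge 0$ let $D_x(s)$ denote the closed disk of radius $s$ centered at $x$. Let $G_{\lambda,\infty}$ be the basic secrecy graph: its vertex set is $\Phi\cup\{o\}$, where $o$ is the origin, and two distinct vertices $x,y$ are adjacent if and only if neither $D_x(\|x-y\|)$ nor $D_y(\|x-y\|)$ contains a point of $\Psi$. Let $N$ be the degree of $o$ in $G_{\lambda,\infty}$, and put \[ a=\frac23+\frac{\sqrt3}{4\pi},\qquad b=\frac14 . \] Then $N$ is a random variable (with values in $\{0,1,2,\dots\}\cup\{\infty\}$), and for every integer $n\ge 0$ \[ 1-\left(\frac{a}{a+\lambda}\right)^{n+1}<\mathbb{P}[N\le n]<1-\left(\frac{b}{b+\lambda}\right)^{n+1}. \] Moreover \[ \frac b\lambda<\mathbb{E}N<\frac a\lambda . \] -/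

import Mathlib

open MeasureTheory ProbabilityTheory Set Metric
open scoped NNReal ENNReal

noncomputable section

/-- The Euclidean plane, with its Euclidean distance and Lebesgue measure. -/
abbrev Plane : Type := EuclideanSpace ℝ (Fin 2)

/-! ### Geometric graphs and secrecy graphs -/

/-- Gilbert's disk graph on the vertex set `φ`: two distinct vertices are adjacent iff their
distance is at most `r`. For `r = ∞` this is the complete graph on `φ`. -/
def gilbertGraph (φ : Set Plane) (r : ℝ≥0∞) : SimpleGraph φ where
  Adj x y := x ≠ y ∧ edist (x : Plane) (y : Plane) ≤ r
  symm := ⟨fun x y h => ⟨h.1.symm, by rw [edist_comm]; exact h.2⟩⟩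
  loopless := ⟨fun _ h => h.1 rfl⟩

/-- The directed secrecy graph obtained from the graph `Ghat` on the good guys `φ` and the set `ψ`
of eavesdroppers: every edge is replaced by two directed edges, and then the directed edge from
`x` to `y` is kept iff there is no eavesdropper in the closed ball around `x` of radius
`‖x - y‖`. -/
def directedSecrecyGraph {φ : Set Plane} (Ghat : SimpleGraph φ) (ψ : Set Plane) : Digraph φ where
  Adj x y := Ghat.Adj x y ∧ ψ ∩ closedBall (x : Plane) (dist (x : Plane) (y : Plane)) = ∅

/-- The basic secrecy graph: `x` and `y` are adjacent iff both directed edges are present in the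
directed secrecy graph. -/
def basicSecrecyGraph {φ : Set Plane} (Ghat : SimpleGraph φ) (ψ : Set Plane) : SimpleGraph φ where
  Adj x y := (directedSecrecyGraph Ghat ψ).Adj x y ∧ (directedSecrecyGraph Ghat ψ).Adj y x
  symm := ⟨fun _ _ h => ⟨h.2, h.1⟩⟩
  loopless := ⟨fun x h => Ghat.loopless.irrefl x h.1.1⟩

/-- The degree of the origin in the basic secrecy graph with maximum range `r`, where the good guys
are the points of `φ` together with a node at the origin. -/
def basicDegreeOrigin (r : ℝ≥0∞) (φ ψ : Set Plane) : ℕ∞ :=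
  ((basicSecrecyGraph (gilbertGraph (insert 0 φ) r) ψ).neighborSet
    ⟨(0 : Plane), mem_insert 0 φ⟩).encard

/-! ### Point processes -/

/-- A locally finite point configuration in the plane. -/
structure PointConfig where
  points : Set Plane
  finite_inter : ∀ B : Set Plane, Bornology.IsBounded B → (points ∩ B).Finite

/-- The number of points of `φ` in `B` (used for bounded `B`, where this number is finite). -/
def PointConfig.count (B : Set Plane) (φ : PointConfig) : ℕ := (φ.points ∩ B).ncard

/-- The usual σ-algebra on configurations, generated by the counts in bounded Borel sets. -/
instance PointConfig.instMeasurableSpace : MeasurableSpace PointConfig :=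
  ⨆ B : {B : Set Plane // MeasurableSet B ∧ Bornology.IsBounded B},
    MeasurableSpace.comap (PointConfig.count B.1) ⊤

/-- `Φ` is a homogeneous Poisson point process in the plane with intensity `lam`: a random locally
finite point configuration such that the number of points in a bounded Borel set `B` is Poisson
distributed with mean `lam * |B|`, and the numbers of points in finitely many pairwise disjoint
bounded Borel sets are independent. -/
structure IsPoissonProcess {Ω : Type*} [MeasurableSpace Ω] (P : Measure Ω)
    (Φ : Ω → PointConfig) (lam : ℝ≥0) : Prop where
  measurable : Measurable Φ
  hasLaw_count : ∀ B : Set Plane, MeasurableSet B → Bornology.IsBounded B →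
    HasLaw (fun ω => (Φ ω).count B) (poissonMeasure (lam * (volume B).toNNReal)) P
  indep_count : ∀ (n : ℕ) (B : Fin n → Set Plane),
    (∀ i, MeasurableSet (B i)) → (∀ i, Bornology.IsBounded (B i)) →
    Pairwise (fun i j => Disjoint (B i) (B j)) →
    iIndepFun (fun i ω => (Φ ω).count (B i)) P

end

/-! Fix the eavesdroppers `ψ`. The neighbours of the origin are the good guys in the open set
`secureRegion ψ` (`basicDegreeOrigin_top`), which is bounded once `ψ` is nonempty. By independence,
the degree given `Ψ = ψ` is then Poisson with mean the area of this set.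

Let `A = emptyDiskArea ψ` be the area of the disk reaching to a nearest eavesdropper `y`. The secure
region contains the disk of half the radius, except its centre, and lies in `cutDisk y`, the part of
the big disk on the origin's side of the bisector of `0` and `y`. Its area is therefore between `b *
A` and `a * A` (`quarter_emptyDiskArea_lt`, `toReal_volume_secureRegion_le`). The Poisson
distribution function strictly decreases in the mean, and `A` is exponential of rate `lam`
(`IsPoissonProcess.map_emptyDiskArea`). Replacing the mean by `c * A` and averaging gives a
geometric law (`lintegral_expMeasure_poissonCDF`), whence the bounds on the distribution; summing
tails gives those on the mean.

Strictness: the lower area bound is strict whenever `A > 0`. For the upper one it is enough to have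
strictness on an event of positive probability, namely `antipodalConfigs`. -/

/-! ### The region of the plane whose points are connected to the origin -/

/-- The set of the points which are adjacent to the origin if they are good guys, where `ψ` is the
set of eavesdroppers. -/
def secureRegion (ψ : Set Plane) : Set Plane :=
  {x | x ≠ 0 ∧ ∀ z ∈ ψ, ‖x‖ < ‖z‖ ∧ ‖x‖ < dist z x}

lemma basicDegreeOrigin_top (φ ψ : Set Plane) :
    basicDegreeOrigin ∞ φ ψ = (φ ∩ secureRegion ψ).encard := by
  rw [basicDegreeOrigin, ← Subtype.val_injective.encard_image]
  congr 1
  ext x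
  simp only [basicSecrecyGraph, directedSecrecyGraph, gilbertGraph, secureRegion, mem_image,
    SimpleGraph.mem_neighborSet, Subtype.exists, mem_inter_iff, mem_ofPred_eq,
    eq_empty_iff_forall_notMem, mem_closedBall, not_and, not_le, exists_and_right, exists_eq_right,
    le_top, and_true, mem_insert_iff, ne_eq, Subtype.mk.injEq, dist_zero_left, dist_zero_right]
  constructor
  · rintro ⟨⟨⟨h, h0⟩, h1⟩, -, h2⟩
    have h0' : x ≠ 0 := fun e => h0 e.symm
    exact ⟨h.resolve_left h0', h0', fun z hz => ⟨h1 z hz, h2 z hz⟩⟩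
  · rintro ⟨h, h0, h1⟩
    exact ⟨⟨⟨Or.inr h, fun e => h0 e.symm⟩, fun z hz => (h1 z hz).1⟩, h0,
      fun z hz => (h1 z hz).2⟩

/-- By local finiteness only finitely many points lie within `r + 1` of `c`, so the minimal distance
is attained and the strict inequality gains a uniform margin. -/
lemma PointConfig.exists_pos_forall_add_lt_dist (ψ : PointConfig) (c : Plane) (r : ℝ)
    (h : ∀ z ∈ ψ.points, r < dist z c) : ∃ ε > 0, ∀ z ∈ ψ.points, r + ε < dist z c := by
  have hfin := ψ.finite_inter (closedBall c (r + 1)) isBounded_closedBall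
  rcases (ψ.points ∩ closedBall c (r + 1)).eq_empty_or_nonempty with he | hne
  · refine ⟨1, one_pos, fun z hz => ?_⟩
    by_contra! hle
    exact notMem_empty z (he ▸ ⟨hz, mem_closedBall.2 hle⟩)
  · obtain ⟨z₀, hz₀, hmin⟩ := exists_min_image _ (fun z => dist z c) hfin hne
    have h₀ := h z₀ hz₀.1
    have h₁ : dist z₀ c ≤ r + 1 := hz₀.2
    refine ⟨(dist z₀ c - r) / 2, by linarith, fun z hz => ?_⟩
    by_cases hzc : dist z c ≤ r + 1
    · have := hmin z ⟨hz, hzc⟩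
      linarith
    · linarith

lemma exists_pos_of_mem_secureRegion (ψ : PointConfig) {x : Plane}
    (hx : x ∈ secureRegion ψ.points) :
    ∃ ε > 0, ∀ z ∈ ψ.points, ‖x‖ + ε < ‖z‖ ∧ ‖x‖ + ε < dist z x := by
  obtain ⟨ε₁, h₁, H₁⟩ := ψ.exists_pos_forall_add_lt_dist 0 ‖x‖
    fun z hz => by simpa using (hx.2 z hz).1
  obtain ⟨ε₂, h₂, H₂⟩ := ψ.exists_pos_forall_add_lt_dist x ‖x‖ fun z hz => (hx.2 z hz).2
  refine ⟨min ε₁ ε₂, lt_min h₁ h₂, fun z hz => ⟨?_, ?_⟩⟩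
  · have := H₁ z hz
    rw [dist_zero_right] at this
    linarith [min_le_left ε₁ ε₂]
  · linarith [min_le_right ε₁ ε₂, H₂ z hz]

lemma isOpen_secureRegion (ψ : PointConfig) : IsOpen (secureRegion ψ.points) := by
  rw [Metric.isOpen_iff]
  intro x hx
  obtain ⟨ε, hε, H⟩ := exists_pos_of_mem_secureRegion ψ hx
  -- Both the norm and the distance to `z` move by less than `ε / 2`; the bound `‖x‖` keeps the ball
  -- away from `0`.
  refine ⟨min (ε / 2) ‖x‖, lt_min (half_pos hε) (norm_pos_iff.2 hx.1), fun y hy => ⟨?_, ?_⟩⟩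
  · rintro rfl
    have := (mem_ball.1 hy).trans_le (min_le_right _ _)
    simp at this
  · intro z hz
    have hyx : dist y x < ε / 2 := (mem_ball.1 hy).trans_le (min_le_left _ _)
    have h1 : ‖y‖ ≤ dist y x + ‖x‖ := by simpa using dist_triangle y x 0
    have h2 := dist_triangle z y x
    obtain ⟨h3, h4⟩ := H z hz
    constructor <;> linarith

lemma secureRegion_subset_ball {ψ : Set Plane} {y : Plane} (hy : y ∈ ψ) :
    secureRegion ψ ⊆ ball 0 ‖y‖ :=
  fun x hx => by simpa using (hx.2 y hy).1

lemma PointConfig.exists_norm_eq_infDist (ψ : PointConfig) (hψ : ψ.points.Nonempty) :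
    ∃ y ∈ ψ.points, ‖y‖ = infDist 0 ψ.points ∧ ∀ z ∈ ψ.points, ‖y‖ ≤ ‖z‖ := by
  obtain ⟨w, hw⟩ := hψ
  have hfin := ψ.finite_inter (closedBall 0 ‖w‖) isBounded_closedBall
  obtain ⟨y, hy, hmin⟩ := exists_min_image _ (fun z : Plane => ‖z‖) hfin ⟨w, hw, by simp⟩
  have key : ∀ z ∈ ψ.points, ‖y‖ ≤ ‖z‖ := by
    intro z hz
    by_cases hzw : ‖z‖ ≤ ‖w‖
    · exact hmin z ⟨hz, by simpa using hzw⟩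
    · exact (hmin w ⟨hw, by simp⟩).trans (not_le.1 hzw).le
  refine ⟨y, hy.1, le_antisymm ?_ ?_, key⟩
  · refine (le_infDist ⟨w, hw⟩).2 fun z hz => ?_
    simpa [dist_zero_left] using key z hz
  · simpa [dist_zero_left] using infDist_le_dist_of_mem (x := (0 : Plane)) hy.1

/-! ### Lower bound for the area of the secure region -/

lemma ball_diff_subset_secureRegion {ψ : Set Plane} {r : ℝ} (h : ∀ z ∈ ψ, r ≤ ‖z‖) :
    ball 0 (r / 2) \ {0} ⊆ secureRegion ψ := by
  rintro x ⟨hx, hx0⟩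
  refine ⟨hx0, fun z hz => ?_⟩
  have h1 : ‖x‖ < r / 2 := by simpa using hx
  have h2 : ‖z‖ ≤ dist z x + ‖x‖ := by simpa using dist_triangle z x 0
  have h3 := h z hz
  have := norm_nonneg x
  constructor <;> linarith

lemma sphere_infinite {r : ℝ} (hr : 0 < r) : (sphere (0 : Plane) r).Infinite := by
  intro hf
  have hrank : 1 < Module.rank ℝ Plane := by
    rw [← Module.finrank_eq_rank]; simp
  have hc := isConnected_sphere hrank (0 : Plane) hr.le
  have hs := hf.countable
  have hne : (sphere (0 : Plane) r).Nontrivial := by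
    refine ⟨EuclideanSpace.single 0 r, by simp [abs_of_pos hr], -EuclideanSpace.single 0 r,
      by simp [abs_of_pos hr], ?_⟩
    intro h
    have := congrArg (fun v : Plane => v 0) h
    simp at this
    linarith
  exact hc.isPreconnected.infinite_of_nontrivial hne hf

/-- Only finitely many eavesdroppers lie on the circle of radius `r`, so some `u` on it is not one
of them. An eavesdropper within `r / 2` of `u / 2` would give equality in the triangle inequality
and hence be `u` itself. -/
lemma exists_mem_secureRegion_half (ψ : PointConfig) {r : ℝ} (hr : 0 < r)
    (h : ∀ z ∈ ψ.points, r ≤ ‖z‖) : ∃ x ∈ secureRegion ψ.points, ‖x‖ = r / 2 := by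
  obtain ⟨u, hu, huψ⟩ := ((sphere_infinite hr).sdiff
    (ψ.finite_inter (closedBall 0 r) isBounded_closedBall)).nonempty
  have hur : ‖u‖ = r := by simpa using hu
  have hu' : u ∉ ψ.points := fun hm => huψ ⟨hm, by simp [hur]⟩
  have hx : ‖(2⁻¹ : ℝ) • u‖ = r / 2 := by rw [norm_smul, hur]; norm_num; ring
  refine ⟨(2⁻¹ : ℝ) • u, ⟨?_, fun z hz => ?_⟩, hx⟩
  · rw [← norm_pos_iff, hx]; positivity
  · have h3 := h z hz
    refine ⟨by linarith, ?_⟩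
    rw [hx]
    by_contra! hle
    rw [dist_eq_norm] at hle
    have h1 : ‖z‖ ≤ r := by
      calc ‖z‖ = ‖(z - (2⁻¹ : ℝ) • u) + (2⁻¹ : ℝ) • u‖ := by simp
        _ ≤ ‖z - (2⁻¹ : ℝ) • u‖ + ‖(2⁻¹ : ℝ) • u‖ := norm_add_le _ _
        _ ≤ r := by linarith
    have hzr : ‖z‖ = r := le_antisymm h1 h3
    have h2 : ‖z - (2⁻¹ : ℝ) • u‖ ^ 2 ≤ (r / 2) ^ 2 := by gcongr
    rw [norm_sub_sq_real, hx, hzr, inner_smul_right] at h2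
    have h4 : ‖z - u‖ ^ 2 ≤ 0 := by
      rw [norm_sub_sq_real, hzr, hur]
      linarith
    have h5 : z - u = 0 := by
      rw [← norm_eq_zero]
      exact pow_eq_zero_iff two_ne_zero |>.1 (le_antisymm h4 (sq_nonneg _))
    exact hu' (sub_eq_zero.1 h5 ▸ hz)

/-- The region is open and contains a point of the circle of radius `r / 2`, so it has positive area
outside that circle. -/
lemma volume_ball_lt_volume_secureRegion (ψ : PointConfig) {r : ℝ} (hr : 0 < r)
    (h : ∀ z ∈ ψ.points, r ≤ ‖z‖) :
    volume (ball (0 : Plane) (r / 2)) < volume (secureRegion ψ.points) := by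
  obtain ⟨x, hx, hxr⟩ := exists_mem_secureRegion_half ψ hr h
  obtain ⟨ε, hε, hball⟩ := Metric.isOpen_iff.1 (isOpen_secureRegion ψ) x hx
  have hU : IsOpen (ball x ε ∩ (closedBall (0 : Plane) (r / 2))ᶜ) :=
    isOpen_ball.inter isClosed_closedBall.isOpen_compl
  have hUne : (ball x ε ∩ (closedBall (0 : Plane) (r / 2))ᶜ).Nonempty := by
    -- As `‖x‖ = r / 2`, this pushes `x` outward by `ε / 2`.
    refine ⟨(1 + ε / r) • x, ?_, ?_⟩
    · rw [mem_ball, dist_eq_norm, add_smul, one_smul, add_sub_cancel_left, norm_smul, hxr,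
        Real.norm_of_nonneg (by positivity)]
      field_simp
      norm_num
    · rw [mem_compl_iff, mem_closedBall, dist_zero_right, norm_smul, hxr,
        Real.norm_of_nonneg (by positivity), not_le]
      field_simp
      nlinarith
  have hd : Disjoint (ball (0 : Plane) (r / 2) \ {0})
      (ball x ε ∩ (closedBall (0 : Plane) (r / 2))ᶜ) := by
    rw [Set.disjoint_left]
    rintro y ⟨hy, -⟩ ⟨-, hy'⟩
    exact hy' (ball_subset_closedBall hy)
  have hv : volume (ball (0 : Plane) (r / 2) \ {0}) = volume (ball (0 : Plane) (r / 2)) :=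
    measure_sdiff_null (measure_singleton _)
  calc volume (ball (0 : Plane) (r / 2))
      < volume (ball (0 : Plane) (r / 2))
        + volume (ball x ε ∩ (closedBall (0 : Plane) (r / 2))ᶜ) :=
        ENNReal.lt_add_right measure_ball_lt_top.ne (hU.measure_pos _ hUne).ne'
    _ = volume ((ball (0 : Plane) (r / 2) \ {0}) ∪
          (ball x ε ∩ (closedBall (0 : Plane) (r / 2))ᶜ)) := by
        rw [measure_union hd hU.measurableSet, hv]
    _ ≤ volume (secureRegion ψ.points) :=
        measure_mono (union_subset (ball_diff_subset_secureRegion h)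
          (inter_subset_left.trans hball))

/-! ### Upper bound for the area of the secure region -/

/-- The points of the disk of radius `‖y‖` around the origin which are closer to the origin than
to `y`. -/
def cutDisk (y : Plane) : Set Plane := {x | ‖x‖ < ‖y‖ ∧ ‖x‖ < dist y x}

lemma secureRegion_subset_cutDisk {ψ : Set Plane} {y : Plane} (hy : y ∈ ψ) :
    secureRegion ψ ⊆ cutDisk y :=
  fun _ hx => hx.2 y hy

lemma isOpen_cutDisk (y : Plane) : IsOpen (cutDisk y) :=
  IsOpen.and (isOpen_lt (by fun_prop) (by fun_prop)) (isOpen_lt (by fun_prop) (by fun_prop))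

lemma mem_cutDisk_iff {x y : Plane} : x ∈ cutDisk y ↔ ‖x‖ < ‖y‖ ∧ 2 * inner ℝ y x < ‖y‖ ^ 2 := by
  refine and_congr_right fun _ => ?_
  rw [dist_eq_norm, ← sq_lt_sq₀ (norm_nonneg _) (norm_nonneg _), norm_sub_sq_real]
  constructor <;> intro h <;> linarith

lemma preimage_cutDisk (f : Plane ≃ₗᵢ[ℝ] Plane) (y : Plane) :
    f ⁻¹' cutDisk (f y) = cutDisk y := by
  ext x
  simp [mem_cutDisk_iff]

/-- The reflection that takes `y` to `z` is an isometry fixing `0`. With scaling, this reduces the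
area to the case of a unit coordinate vector. -/
lemma volume_cutDisk_eq_of_norm_eq {y z : Plane} (h : ‖y‖ = ‖z‖) :
    volume (cutDisk y) = volume (cutDisk z) := by
  have hf := Submodule.reflection_sub h
  rw [← preimage_cutDisk ((ℝ ∙ (y - z))ᗮ.reflection) y, hf]
  exact (LinearIsometryEquiv.measurePreserving _).measure_preimage
    (isOpen_cutDisk z).measurableSet.nullMeasurableSet

open scoped Pointwise in
lemma smul_cutDisk {r : ℝ} (hr : 0 < r) (y : Plane) : r • cutDisk y = cutDisk (r • y) := by
  ext x
  rw [Set.mem_smul_set_iff_inv_smul_mem₀ hr.ne']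
  have hx : x = r • (r⁻¹ • x) := by rw [smul_smul, mul_inv_cancel₀ hr.ne', one_smul]
  generalize r⁻¹ • x = w at hx
  subst hx
  simp only [cutDisk, mem_ofPred_eq, norm_smul, dist_smul₀, Real.norm_of_nonneg hr.le]
  rw [mul_lt_mul_iff_right₀ hr, mul_lt_mul_iff_right₀ hr]

/-! ### The area of the cut disk -/

lemma integral_two_mul_sqrt_one_sub_sq :
    ∫ s in (-1 : ℝ)..(1 / 2), 2 * √(1 - s ^ 2) = 2 * Real.pi / 3 + √3 / 4 := by
  -- The derivative is needed only on the open interval: `arcsin` is not differentiable at `-1`.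
  have h := intervalIntegral.integral_eq_sub_of_hasDerivAt_of_le (a := -1) (b := 1 / 2)
    (f := fun s : ℝ => Real.arcsin s + s * √(1 - s ^ 2)) (f' := fun s => 2 * √(1 - s ^ 2))
    (by norm_num) (by fun_prop) ?_ ((by fun_prop : Continuous _).intervalIntegrable _ _)
  · rw [h]
    have h1 : √(1 - (1 / 2 : ℝ) ^ 2) = √3 / 2 := by
      rw [show (1 - (1 / 2 : ℝ) ^ 2) = 3 / 2 ^ 2 by norm_num, Real.sqrt_div (by norm_num),
        Real.sqrt_sq (by norm_num)]
    have h2 : Real.arcsin (1 / 2) = Real.pi / 6 := by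
      rw [← Real.sin_pi_div_six, Real.arcsin_sin] <;> linarith [Real.pi_pos]
    simp only [h1, h2, Real.arcsin_neg_one]
    norm_num
    ring
  · rintro s ⟨hs1, hs2⟩
    have hpos : 0 < 1 - s ^ 2 := by nlinarith
    have h0 : √(1 - s ^ 2) ≠ 0 := (Real.sqrt_pos.2 hpos).ne'
    have d1 := Real.hasDerivAt_arcsin (x := s) (by linarith) (by linarith)
    have d2 : HasDerivAt (fun s : ℝ => 1 - s ^ 2) (-(2 * s)) s := by
      simpa using (hasDerivAt_pow 2 s).const_sub 1
    have d3 := d1.add ((hasDerivAt_id s).mul (d2.sqrt hpos.ne'))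
    refine d3.congr_deriv ?_
    simp only [id]
    field_simp
    rw [Real.sq_sqrt hpos.le]
    ring

/-- In coordinates this is the part of the unit disk with abscissa below `1 / 2`, a region between
two graphs. -/
lemma volume_cutDisk_single :
    volume (cutDisk (EuclideanSpace.single 0 1)) =
      ENNReal.ofReal (2 * Real.pi / 3 + √3 / 4) := by
  have hmp : MeasurePreserving
      (MeasurableEquiv.finTwoArrow ∘ (MeasurableEquiv.toLp 2 (Fin 2 → ℝ)).symm)
      (volume : Measure Plane) volume :=
    (volume_preserving_finTwoArrow ℝ).comp
      (EuclideanSpace.volume_preserving_symm_measurableEquiv_toLp (Fin 2))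
  have hcont : Continuous fun s : ℝ => √(1 - s ^ 2) := by fun_prop
  have hneg : Continuous fun s : ℝ => -√(1 - s ^ 2) := by fun_prop
  have hpre : cutDisk (EuclideanSpace.single 0 1) =
      (MeasurableEquiv.finTwoArrow ∘ (MeasurableEquiv.toLp 2 (Fin 2 → ℝ)).symm) ⁻¹'
        regionBetween (fun s : ℝ => -√(1 - s ^ 2)) (fun s => √(1 - s ^ 2)) (Ioo (-1) (1 / 2)) := by
    ext x
    have hx : (MeasurableEquiv.finTwoArrow ∘ (MeasurableEquiv.toLp 2 (Fin 2 → ℝ)).symm) x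
        = (x 0, x 1) := rfl
    rw [mem_preimage, hx, mem_cutDisk_iff, EuclideanSpace.inner_single_left,
      PiLp.norm_single, EuclideanSpace.norm_eq, Fin.sum_univ_two]
    simp only [regionBetween, mem_ofPred_eq, mem_Ioo, Real.norm_eq_abs, sq_abs, abs_one, map_one,
      one_mul, one_pow]
    rw [Real.sqrt_lt' one_pos, ← abs_lt, Real.lt_sqrt (abs_nonneg _), sq_abs]
    constructor
    · rintro ⟨h1, h2⟩
      exact ⟨⟨by nlinarith [sq_nonneg (x 1)], by linarith⟩, by linarith⟩
    · rintro ⟨⟨h1, h2⟩, h3⟩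
      exact ⟨by linarith, by linarith⟩
  rw [hpre, hmp.measure_preimage (measurableSet_regionBetween (by fun_prop) (by fun_prop)
    measurableSet_Ioo).nullMeasurableSet, Measure.volume_eq_prod, volume_regionBetween_eq_integral
    (hneg.integrableOn_Icc.mono_set Ioo_subset_Icc_self)
    (hcont.integrableOn_Icc.mono_set Ioo_subset_Icc_self) measurableSet_Ioo
    fun s _ => neg_le_self (Real.sqrt_nonneg _), ← integral_two_mul_sqrt_one_sub_sq,
    intervalIntegral.integral_of_le (by norm_num), ← integral_Ioc_eq_integral_Ioo]
  congr 2 with s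
  simp only [Pi.sub_apply]
  ring

lemma volume_cutDisk {y : Plane} (hy : y ≠ 0) :
    volume (cutDisk y) =
      ENNReal.ofReal ((2 / 3 + √3 / (4 * Real.pi)) * (Real.pi * ‖y‖ ^ 2)) := by
  have hy' := norm_pos_iff.2 hy
  rw [volume_cutDisk_eq_of_norm_eq (z := ‖y‖ • EuclideanSpace.single 0 (1 : ℝ)),
    ← smul_cutDisk hy', Measure.addHaar_smul, volume_cutDisk_single,
    ← ENNReal.ofReal_mul (abs_nonneg _)]
  · congr 1
    rw [finrank_euclideanSpace_fin, abs_of_pos (by positivity)]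
    field_simp
  · simp [norm_smul]

lemma volume_secureRegion_le {ψ : Set Plane} {y : Plane} (hy : y ∈ ψ) (hy0 : y ≠ 0) :
    volume (secureRegion ψ) ≤
      ENNReal.ofReal ((2 / 3 + √3 / (4 * Real.pi)) * (Real.pi * ‖y‖ ^ 2)) :=
  volume_cutDisk hy0 ▸ measure_mono (secureRegion_subset_cutDisk hy)

/-- The second eavesdropper `z` removes from `cutDisk y` a neighbourhood of `x`, which has positive
area. -/
lemma volume_secureRegion_lt {ψ : Set Plane} {x y z : Plane} (hy : y ∈ ψ) (hy0 : y ≠ 0)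
    (hz : z ∈ ψ) (hxy : x ∈ cutDisk y) (hxz : dist z x < ‖x‖) :
    volume (secureRegion ψ) <
      ENNReal.ofReal ((2 / 3 + √3 / (4 * Real.pi)) * (Real.pi * ‖y‖ ^ 2)) := by
  rw [← volume_cutDisk hy0]
  have hU : IsOpen (cutDisk y ∩ {w | dist z w < ‖w‖}) :=
    (isOpen_cutDisk y).inter (isOpen_lt (by fun_prop) (by fun_prop))
  have hd : Disjoint (secureRegion ψ) (cutDisk y ∩ {w | dist z w < ‖w‖}) := by
    rw [Set.disjoint_left]
    rintro w hw ⟨-, hw'⟩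
    exact lt_asymm (hw.2 z hz).2 hw'
  have hfin : volume (secureRegion ψ) ≠ ∞ :=
    ((measure_mono (secureRegion_subset_ball hy)).trans_lt measure_ball_lt_top).ne
  calc volume (secureRegion ψ)
      < volume (secureRegion ψ) + volume (cutDisk y ∩ {w | dist z w < ‖w‖}) :=
        ENNReal.lt_add_right hfin (hU.measure_pos _ ⟨x, hxy, hxz⟩).ne'
    _ = volume (secureRegion ψ ∪ (cutDisk y ∩ {w | dist z w < ‖w‖})) :=
        (measure_union hd hU.measurableSet).symm
    _ ≤ volume (cutDisk y) :=
        measure_mono (union_subset (secureRegion_subset_cutDisk hy) inter_subset_left)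

/-- Eavesdroppers near two antipodal points of the unit circle exclude more than one half plane. -/
lemma volume_secureRegion_lt_of_antipodal {ψ : Set Plane} {e y z₁ z₂ : Plane} (he : ‖e‖ = 1)
    (hfar : ∀ z ∈ ψ, 9 / 10 ≤ ‖z‖) (hy : y ∈ ψ)
    (hz₁ : z₁ ∈ ψ) (h₁ : dist z₁ e < 1 / 10) (hz₂ : z₂ ∈ ψ) (h₂ : dist z₂ (-e) < 1 / 10) :
    volume (secureRegion ψ) <
      ENNReal.ofReal ((2 / 3 + √3 / (4 * Real.pi)) * (Real.pi * ‖y‖ ^ 2)) := by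
  have hy9 := hfar y hy
  have hy0 : y ≠ 0 := by rw [← norm_pos_iff]; linarith
  have aux : ∀ e z : Plane, ‖e‖ = 1 → inner ℝ y e ≤ 0 → z ∈ ψ → dist z e < 1 / 10 →
      volume (secureRegion ψ) <
        ENNReal.ofReal ((2 / 3 + √3 / (4 * Real.pi)) * (Real.pi * ‖y‖ ^ 2)) := by
    -- The witness `(7 / 10) • e` is in `cutDisk y`, since `7 / 10 < 9 / 10 ≤ ‖y‖` and `e` points
    -- away from `y`. Its distance to `z` is below `1 / 10 + 3 / 10 < 7 / 10`. One of `e`, `-e`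
    -- always satisfies the sign condition.
    intro e z he hi hz hd
    have hn : ‖(7 / 10 : ℝ) • e‖ = 7 / 10 := by rw [norm_smul, he]; norm_num
    have hn' : dist e ((7 / 10 : ℝ) • e) = 3 / 10 := by
      rw [dist_eq_norm, show e - (7 / 10 : ℝ) • e = (3 / 10 : ℝ) • e by module, norm_smul, he]
      norm_num
    refine volume_secureRegion_lt (x := (7 / 10 : ℝ) • e) hy hy0 hz ?_ ?_
    · rw [mem_cutDisk_iff, hn, inner_smul_right]
      exact ⟨by linarith, by nlinarith⟩
    · rw [hn]
      linarith [dist_triangle z e ((7 / 10 : ℝ) • e)]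
  rcases le_total (inner ℝ y e) 0 with hi | hi
  · exact aux e z₁ he hi hz₁ h₁
  · exact aux (-e) z₂ (by simpa using he) (by simpa using hi) hz₂ h₂

/-! ### Measurability of the degree of the origin -/

lemma PointConfig.measurable_count {B : Set Plane} (hB : MeasurableSet B)
    (hb : Bornology.IsBounded B) : Measurable (PointConfig.count B) :=
  (comap_measurable _).mono (le_iSup (fun B : {B : Set Plane // MeasurableSet B ∧
    Bornology.IsBounded B} => MeasurableSpace.comap (PointConfig.count B.1) ⊤) ⟨B, hB, hb⟩) le_rfl

lemma PointConfig.count_eq_zero_iff {B : Set Plane} (hb : Bornology.IsBounded B)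
    (φ : PointConfig) : φ.count B = 0 ↔ φ.points ∩ B = ∅ :=
  Set.ncard_eq_zero (φ.finite_inter B hb)

lemma PointConfig.measurableSet_inter_eq_empty {B : Set Plane} (hB : MeasurableSet B)
    (hb : Bornology.IsBounded B) : MeasurableSet {φ : PointConfig | φ.points ∩ B = ∅} := by
  simp_rw [← PointConfig.count_eq_zero_iff hb]
  exact PointConfig.measurable_count hB hb (measurableSet_singleton 0)

/-- A countable family of small balls that separates the points of the plane. -/
def denseBall (g : ℕ × ℕ) : Set Plane :=
  ball (TopologicalSpace.denseSeq Plane g.1) (1 / (g.2 + 1))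

/-- A bounded open set containing all disks that have to be free of eavesdroppers in order to
connect the origin to a point of `denseBall g`. -/
def denseGuard (g : ℕ × ℕ) : Set Plane :=
  ball 0 (‖TopologicalSpace.denseSeq Plane g.1‖ + 1 / (g.2 + 1)) ∪
    ball (TopologicalSpace.denseSeq Plane g.1)
      (‖TopologicalSpace.denseSeq Plane g.1‖ + 2 * (1 / (g.2 + 1)))

lemma denseBall_diff_subset_secureRegion {ψ : Set Plane} {g : ℕ × ℕ}
    (h : ψ ∩ denseGuard g = ∅) : denseBall g \ {0} ⊆ secureRegion ψ := by
  rintro y ⟨hy, hy0⟩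
  refine ⟨hy0, fun z hz => ?_⟩
  have hz' : z ∉ denseGuard g := fun hzg => notMem_empty z (h ▸ ⟨hz, hzg⟩)
  simp only [denseGuard, mem_union, mem_ball, dist_zero_right, not_or, not_lt] at hz'
  rw [denseBall, mem_ball] at hy
  have h1 := dist_triangle z y (TopologicalSpace.denseSeq Plane g.1)
  have h2 : ‖y‖ ≤ dist y (TopologicalSpace.denseSeq Plane g.1)
      + ‖TopologicalSpace.denseSeq Plane g.1‖ := by
    simpa using dist_triangle y (TopologicalSpace.denseSeq Plane g.1) 0
  constructor <;> linarith

lemma exists_denseBall_family {k : ℕ} (ψ : PointConfig) {f : Fin k → Plane}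
    (hf : Function.Injective f) (hfψ : ∀ i, f i ∈ secureRegion ψ.points) :
    ∃ g : Fin k → ℕ × ℕ, (Pairwise fun i j => Disjoint (denseBall (g i)) (denseBall (g j))) ∧
      ∀ i, f i ∈ denseBall (g i) ∧ ψ.points ∩ denseGuard (g i) = ∅ := by
  choose ε hε H using fun i => exists_pos_of_mem_secureRegion ψ (hfψ i)
  -- Four radii are lost both in joining `f i` to `f j` through a common point of their balls, and
  -- in comparing the second disk of `denseGuard` with the distance to `f i`.
  have hlim : Filter.Tendsto (fun n : ℕ => 4 * (1 / ((n : ℝ) + 1))) Filter.atTop (nhds 0) := by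
    simpa using tendsto_one_div_add_atTop_nhds_zero_nat.const_mul (4 : ℝ)
  have h1 : ∀ᶠ n : ℕ in Filter.atTop, ∀ i, 4 * (1 / ((n : ℝ) + 1)) < ε i :=
    Filter.eventually_all.2 fun i => hlim.eventually_lt_const (hε i)
  have h2 : ∀ᶠ n : ℕ in Filter.atTop, ∀ i j, i ≠ j →
      4 * (1 / ((n : ℝ) + 1)) < dist (f i) (f j) :=
    Filter.eventually_all.2 fun i => Filter.eventually_all.2 fun j => by
      by_cases hij : i = j
      · simp [hij]
      · filter_upwards [hlim.eventually_lt_const (dist_pos.2 (hf.ne hij))] with n hn _ using hn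
  obtain ⟨n, hn1, hn2⟩ := (h1.and h2).exists
  have hn : (0 : ℝ) < 1 / (n + 1) := by positivity
  have hq : ∀ i, ∃ m, dist (f i) (TopologicalSpace.denseSeq Plane m) < 1 / ((n : ℝ) + 1) :=
    fun i => (TopologicalSpace.denseRange_denseSeq Plane).exists_dist_lt (f i) hn
  choose m hm using hq
  refine ⟨fun i => (m i, n), fun i j hij => ?_, fun i => ⟨mem_ball.2 (hm i), ?_⟩⟩
  · refine Set.disjoint_left.2 ?_
    intro y hyi hyj
    simp only [denseBall, mem_ball] at hyi hyj
    have h3 := hn2 i j hij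
    have h4 := dist_triangle4 (f i) (TopologicalSpace.denseSeq Plane (m i)) y (f j)
    have h5 := dist_triangle_right y (f j) (TopologicalSpace.denseSeq Plane (m j))
    have h6 := hm i
    have h7 := hm j
    rw [dist_comm (TopologicalSpace.denseSeq Plane (m i)) y] at h4
    linarith
  · rw [eq_empty_iff_forall_notMem]
    rintro z ⟨hz, hzg⟩
    obtain ⟨h3, h4⟩ := H i z hz
    have h5 := hn1 i
    have h6 := hm i
    have h7 : ‖TopologicalSpace.denseSeq Plane (m i)‖ ≤
        dist (f i) (TopologicalSpace.denseSeq Plane (m i)) + ‖f i‖ := by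
      simpa [dist_comm] using dist_triangle (TopologicalSpace.denseSeq Plane (m i)) (f i) 0
    have h8 := dist_triangle_right z (f i) (TopologicalSpace.denseSeq Plane (m i))
    rcases hzg with hzg | hzg
    · simp only [mem_ball, dist_zero_right] at hzg
      linarith
    · simp only [mem_ball] at hzg
      linarith

/-- The right side ranges over a countable set of `g` and involves only whether bounded Borel sets
are empty, so it gives joint measurability. Disjoint balls make the chosen neighbours distinct. -/
lemma le_basicDegreeOrigin_iff (k : ℕ) (φ ψ : PointConfig) :
    (k : ℕ∞) ≤ basicDegreeOrigin ∞ φ.points ψ.points ↔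
      ∃ g : Fin k → ℕ × ℕ, (Pairwise fun i j => Disjoint (denseBall (g i)) (denseBall (g j))) ∧
        ∀ i, φ.points ∩ (denseBall (g i) \ {0}) ≠ ∅ ∧ ψ.points ∩ denseGuard (g i) = ∅ := by
  rw [basicDegreeOrigin_top]
  constructor
  · intro hk
    obtain ⟨t, ht, htk⟩ := Set.exists_subset_encard_eq hk
    have htfin : t.Finite := Set.finite_of_encard_eq_coe htk
    have : Fintype t := htfin.fintype
    have hcard : Fintype.card t = k := by
      have := Set.encard_eq_coe_toFinset_card t
      rw [htk, Set.toFinset_card] at this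
      exact_mod_cast this.symm
    let e := (Fintype.equivFinOfCardEq hcard).symm
    obtain ⟨g, hg, hg'⟩ := exists_denseBall_family ψ (f := fun i => (e i : Plane))
      (Subtype.val_injective.comp e.injective) fun i => (ht (e i).2).2
    refine ⟨g, hg, fun i => ⟨?_, (hg' i).2⟩⟩
    exact Set.nonempty_iff_ne_empty.1 ⟨e i, (ht (e i).2).1, (hg' i).1, (ht (e i).2).2.1⟩
  · rintro ⟨g, hg, hg'⟩
    choose f hf using fun i => Set.nonempty_iff_ne_empty.2 (hg' i).1
    have hinj : Function.Injective f := by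
      intro i j hij
      by_contra hne
      exact Set.disjoint_left.1 (hg hne) (hf i).2.1 (hij ▸ (hf j).2.1)
    have hsub : Set.range f ⊆ φ.points ∩ secureRegion ψ.points := by
      rintro - ⟨i, rfl⟩
      exact ⟨(hf i).1, denseBall_diff_subset_secureRegion (hg' i).2 (hf i).2⟩
    calc (k : ℕ∞) = (Set.range f).encard := by
          rw [← Set.image_univ, hinj.encard_image, Set.encard_univ]; simp
      _ ≤ _ := Set.encard_le_encard hsub

lemma measurable_basicDegreeOrigin :
    Measurable fun p : PointConfig × PointConfig =>
      basicDegreeOrigin ∞ p.1.points p.2.points := by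
  have key : ∀ k : ℕ, MeasurableSet {p : PointConfig × PointConfig |
      (k : ℕ∞) ≤ basicDegreeOrigin ∞ p.1.points p.2.points} := by
    intro k
    have : {p : PointConfig × PointConfig |
        (k : ℕ∞) ≤ basicDegreeOrigin ∞ p.1.points p.2.points} =
        ⋃ g ∈ {g : Fin k → ℕ × ℕ |
          Pairwise fun i j => Disjoint (denseBall (g i)) (denseBall (g j))}, ⋂ i,
          {φ : PointConfig | φ.points ∩ (denseBall (g i) \ {0}) = ∅}ᶜ ×ˢ
            {ψ : PointConfig | ψ.points ∩ denseGuard (g i) = ∅} := by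
      ext p
      simp [le_basicDegreeOrigin_iff]
    rw [this]
    refine MeasurableSet.biUnion (Set.to_countable _) fun g _ => MeasurableSet.iInter fun i => ?_
    refine (PointConfig.measurableSet_inter_eq_empty ?_ ?_).compl.prod
      (PointConfig.measurableSet_inter_eq_empty ?_ ?_)
    · exact measurableSet_ball.diff (measurableSet_singleton 0)
    · exact isBounded_ball.subset sdiff_subset
    · exact measurableSet_ball.union measurableSet_ball
    · exact isBounded_ball.union isBounded_ball
  rw [ENat.measurable_iff]
  intro n
  convert (key n).diff (key (n + 1)) using 1
  ext p
  simp only [mem_preimage, mem_singleton_iff, mem_sdiff, mem_ofPred_eq, Nat.cast_add, Nat.cast_one,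
    not_le, ENat.lt_add_one_iff (ENat.natCast_ne_top n)]
  rw [and_comm, ← le_antisymm_iff]

/-! ### The distribution function of the Poisson distribution -/

/-- The probability that a Poisson random variable of mean `u` is at most `n`. -/
noncomputable def poissonCDF (n : ℕ) (u : ℝ) : ℝ :=
  ∑ j ∈ Finset.range (n + 1), Real.exp (-u) * u ^ j / j.factorial

lemma poissonMeasure_setOf_le (r : ℝ≥0) (n : ℕ) :
    poissonMeasure r {j | j ≤ n} = ENNReal.ofReal (poissonCDF n r) := by
  have : {j | j ≤ n} = ((Finset.range (n + 1) : Finset ℕ) : Set ℕ) := by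
    ext j
    simp
  rw [this, ← sum_measure_singleton, poissonCDF, ENNReal.ofReal_sum_of_nonneg]
  · simp_rw [poissonMeasure_singleton]
  · intro j _
    positivity

lemma measurable_poissonCDF (n : ℕ) : Measurable (poissonCDF n) := by
  unfold poissonCDF
  fun_prop

lemma poissonCDF_pos (n : ℕ) {u : ℝ} (hu : 0 ≤ u) : 0 < poissonCDF n u := by
  refine Finset.sum_pos' (fun j _ => by positivity) ⟨0, by simp, ?_⟩
  simpa using Real.exp_pos _

/-- The derivatives of the summands telescope, leaving only the last term. -/
lemma hasDerivAt_poissonCDF (n : ℕ) (u : ℝ) :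
    HasDerivAt (poissonCDF n) (-(Real.exp (-u) * u ^ n / n.factorial)) u := by
  have hexp : HasDerivAt (fun u : ℝ => Real.exp (-u)) (-Real.exp (-u)) u := by
    simpa using (hasDerivAt_neg u).exp
  induction n with
  | zero =>
    have : poissonCDF 0 = fun u => Real.exp (-u) := by
      ext u
      simp [poissonCDF]
    rw [this]
    simpa using hexp
  | succ n ih =>
    have : poissonCDF (n + 1) = fun u => poissonCDF n u +
        Real.exp (-u) * u ^ (n + 1) / (n + 1).factorial := by
      ext u
      rw [poissonCDF, Finset.sum_range_succ, ← poissonCDF]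
    rw [this]
    refine (ih.add ((hexp.mul (hasDerivAt_pow (n + 1) u)).div_const _)).congr_deriv ?_
    rw [Nat.factorial_succ]
    push_cast
    field_simp
    simp

lemma strictAntiOn_poissonCDF (n : ℕ) : StrictAntiOn (poissonCDF n) (Ici 0) := by
  refine strictAntiOn_of_deriv_neg (convex_Ici 0)
    (fun u _ => (hasDerivAt_poissonCDF n u).continuousAt.continuousWithinAt) fun u hu => ?_
  rw [interior_Ici] at hu
  have : 0 < u := hu
  rw [(hasDerivAt_poissonCDF n u).deriv]
  exact neg_neg_of_pos (by positivity)

/-- Times the exponential density, the integrand is a constant multiple of the Gamma density of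
shape `j + 1` and rate `c + r`, whose integral is one. -/
lemma lintegral_expMeasure_exp_mul_pow {c r : ℝ} (hc : 0 < c) (hr : 0 < r) (j : ℕ) :
    ∫⁻ u, ENNReal.ofReal (Real.exp (-(c * u)) * (c * u) ^ j / j.factorial) ∂expMeasure r =
      ENNReal.ofReal (r / (c + r) * (c / (c + r)) ^ j) := by
  have hcr : 0 < c + r := add_pos hc hr
  have hfun : ∀ u : ℝ, gammaPDF 1 r u *
      ENNReal.ofReal (Real.exp (-(c * u)) * (c * u) ^ j / j.factorial) =
      ENNReal.ofReal (r / (c + r) * (c / (c + r)) ^ j) * gammaPDF (j + 1) (c + r) u := by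
    intro u
    rcases lt_or_ge u 0 with hu | hu
    · simp [gammaPDF_of_neg hu]
    · rw [gammaPDF_of_nonneg hu, gammaPDF_of_nonneg hu, ← ENNReal.ofReal_mul (by positivity),
        ← ENNReal.ofReal_mul (by positivity)]
      congr 1
      rw [Real.Gamma_one, Real.Gamma_nat_eq_factorial, sub_self, Real.rpow_zero, Real.rpow_one,
        add_sub_cancel_right, Real.rpow_natCast, add_mul, neg_add, Real.exp_add,
        show ((j : ℝ) + 1) = ((j + 1 : ℕ) : ℝ) by push_cast; ring, Real.rpow_natCast, mul_pow, div_pow]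
      field_simp
      ring
  have hmeas : Measurable (gammaPDF 1 r) := (measurable_gammaPDFReal 1 r).ennreal_ofReal
  have hmeas' : Measurable (gammaPDF (j + 1) (c + r)) :=
    (measurable_gammaPDFReal _ _).ennreal_ofReal
  rw [expMeasure, gammaMeasure, lintegral_withDensity_eq_lintegral_mul _ hmeas
    (by fun_prop)]
  simp only [Pi.mul_apply]
  rw [lintegral_congr hfun, lintegral_const_mul _ hmeas',
    lintegral_gammaPDF_eq_one (by positivity) hcr, mul_one]

/-- A Poisson distribution whose mean has an exponential distribution is geometric. -/
lemma lintegral_expMeasure_poissonCDF {c r : ℝ} (hc : 0 < c) (hr : 0 < r) (n : ℕ) :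
    ∫⁻ u, ENNReal.ofReal (poissonCDF n (c * u)) ∂expMeasure r =
      ENNReal.ofReal (1 - (c / (c + r)) ^ (n + 1)) := by
  have hcr : 0 < c + r := add_pos hc hr
  have hpos : ∀ᵐ u ∂expMeasure r, 0 ≤ u := by
    have := isProbabilityMeasure_expMeasure hr
    have h := cdf_expMeasure_eq hr 0
    rw [cdf_eq_real] at h
    simp only [le_refl, if_true, mul_zero, neg_zero, Real.exp_zero, sub_self] at h
    rw [measureReal_eq_zero_iff] at h
    filter_upwards [measure_eq_zero_iff_ae_notMem.1 h] with u hu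
    exact (not_le.1 hu).le
  have hcongr : ∫⁻ u, ENNReal.ofReal (poissonCDF n (c * u)) ∂expMeasure r =
      ∫⁻ u, ∑ j ∈ Finset.range (n + 1),
        ENNReal.ofReal (Real.exp (-(c * u)) * (c * u) ^ j / j.factorial) ∂expMeasure r := by
    refine lintegral_congr_ae ?_
    filter_upwards [hpos] with u hu
    rw [poissonCDF, ENNReal.ofReal_sum_of_nonneg fun j _ => by positivity]
  rw [hcongr, lintegral_finsetSum _ fun j _ => by fun_prop]
  simp_rw [lintegral_expMeasure_exp_mul_pow hc hr]
  rw [← ENNReal.ofReal_sum_of_nonneg fun j _ => by positivity, ← Finset.mul_sum]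
  congr 1
  have hne : c / (c + r) ≠ 1 := by
    rw [Ne, div_eq_one_iff_eq hcr.ne']
    linarith
  rw [geom_sum_eq hne]
  have : c / (c + r) - 1 = -(r / (c + r)) := by field_simp; ring
  rw [this]
  field_simp
  ring

/-! ### The nearest eavesdropper -/

section PoissonProcess

variable {Ω : Type*} [MeasurableSpace Ω] {P : Measure Ω} {Φ Ψ : Ω → PointConfig} {lam : ℝ≥0}

lemma IsPoissonProcess.map_count_le (hΦ : IsPoissonProcess P Φ lam) {B : Set Plane}
    (hB : MeasurableSet B) (hb : Bornology.IsBounded B) (n : ℕ) :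
    (P.map Φ) {φ | φ.count B ≤ n} =
      ENNReal.ofReal (poissonCDF n (lam * (volume B).toReal)) := by
  have h := (hΦ.hasLaw_count B hB hb).map_eq
  have hm := PointConfig.measurable_count hB hb
  have hmap : P.map (fun ω => (Φ ω).count B) = (P.map Φ).map (PointConfig.count B) :=
    (Measure.map_map hm hΦ.measurable).symm
  rw [hmap] at h
  have h' := poissonMeasure_setOf_le (lam * (volume B).toNNReal) n
  rw [← h, Measure.map_apply hm MeasurableSet.of_discrete] at h'
  simpa [ENNReal.coe_toNNReal_eq_toReal] using h'

lemma IsPoissonProcess.measure_inter_eq_empty (hΨ : IsPoissonProcess P Ψ lam) {B : Set Plane}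
    (hB : MeasurableSet B) (hb : Bornology.IsBounded B) :
    P {ω | (Ψ ω).points ∩ B = ∅} = ENNReal.ofReal (Real.exp (-(lam * (volume B).toReal))) := by
  have h := hΨ.map_count_le hB hb 0
  have hm : MeasurableSet {ψ : PointConfig | ψ.count B ≤ 0} :=
    PointConfig.measurable_count hB hb measurableSet_Iic
  rw [Measure.map_apply hΨ.measurable hm] at h
  simpa [PointConfig.count_eq_zero_iff hb, poissonCDF] using h

lemma volume_closedBall_toReal {r : ℝ} (hr : 0 ≤ r) :
    (volume (closedBall (0 : Plane) r)).toReal = Real.pi * r ^ 2 := by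
  rw [EuclideanSpace.volume_closedBall_fin_two, ← ENNReal.ofReal_pow hr,
    ← ENNReal.ofReal_mul (by positivity), ENNReal.toReal_ofReal (by positivity), mul_comm]

lemma IsPoissonProcess.ae_nonempty (hΨ : IsPoissonProcess P Ψ lam) (hlam : 0 < lam) :
    ∀ᵐ ω ∂P, (Ψ ω).points.Nonempty := by
  rw [ae_iff]
  -- These are the void probabilities of the disks of radius `√n`.
  have hlim : Filter.Tendsto (fun n : ℕ => ENNReal.ofReal (Real.exp (-(lam * (Real.pi * n)))))
      Filter.atTop (nhds 0) := by
    rw [← ENNReal.ofReal_zero]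
    refine ENNReal.tendsto_ofReal (Real.tendsto_exp_neg_atTop_nhds_zero.comp ?_)
    exact (tendsto_natCast_atTop_atTop.const_mul_atTop Real.pi_pos).const_mul_atTop
      (NNReal.coe_pos.2 hlam)
  refine le_antisymm (ge_of_tendsto' hlim fun n => ?_) zero_le
  have h := hΨ.measure_inter_eq_empty (B := closedBall 0 √n) measurableSet_closedBall
    isBounded_closedBall
  rw [volume_closedBall_toReal (Real.sqrt_nonneg _), Real.sq_sqrt (Nat.cast_nonneg n)] at h
  rw [← h]
  refine measure_mono fun ω hω => ?_
  rw [mem_ofPred_eq, Set.not_nonempty_iff_eq_empty] at hω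
  simp [hω]

/-- Nonemptiness must be stated because `infDist` to the empty set is `0`. In particular `0 <
emptyDiskArea ψ` will include that `ψ` has points. -/
lemma PointConfig.lt_infDist_iff (ψ : PointConfig) {r : ℝ} (hr : 0 ≤ r) :
    r < infDist 0 ψ.points ↔ ψ.points.Nonempty ∧ ψ.points ∩ closedBall 0 r = ∅ := by
  rw [eq_empty_iff_forall_notMem]
  constructor
  · intro h
    refine ⟨?_, fun z hz => ?_⟩
    · by_contra hne
      rw [Set.not_nonempty_iff_eq_empty] at hne
      rw [hne, infDist_empty] at h
      linarith
    · have h1 := infDist_le_dist_of_mem (x := (0 : Plane)) hz.1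
      have h2 := mem_closedBall'.1 hz.2
      linarith
  · rintro ⟨hne, h⟩
    obtain ⟨y, hy, hyd, -⟩ := ψ.exists_norm_eq_infDist hne
    rw [← hyd]
    by_contra! hle
    exact h y ⟨hy, by simpa using hle⟩

lemma PointConfig.measurableSet_nonempty :
    MeasurableSet {ψ : PointConfig | ψ.points.Nonempty} := by
  have : {ψ : PointConfig | ψ.points.Nonempty} =
      ⋃ n : ℕ, {ψ : PointConfig | ψ.points ∩ closedBall 0 n = ∅}ᶜ := by
    ext ψ
    simp only [mem_ofPred_eq, mem_iUnion, mem_compl_iff, ← Set.nonempty_iff_ne_empty]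
    constructor
    · rintro ⟨z, hz⟩
      obtain ⟨n, hn⟩ := exists_nat_ge ‖z‖
      exact ⟨n, z, hz, by simpa using hn⟩
    · rintro ⟨n, z, hz, -⟩
      exact ⟨z, hz⟩
  rw [this]
  exact MeasurableSet.iUnion fun n => (PointConfig.measurableSet_inter_eq_empty
    measurableSet_closedBall isBounded_closedBall).compl

lemma PointConfig.measurable_infDist :
    Measurable fun ψ : PointConfig => infDist 0 ψ.points := by
  refine measurable_of_Ioi fun r => ?_
  rcases lt_or_ge r 0 with hr | hr
  · convert MeasurableSet.univ
    ext ψ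
    simpa using hr.trans_le infDist_nonneg
  · convert PointConfig.measurableSet_nonempty.inter (PointConfig.measurableSet_inter_eq_empty
      (measurableSet_closedBall (x := (0 : Plane)) (ε := r)) isBounded_closedBall) using 1
    ext ψ
    exact ψ.lt_infDist_iff hr

/-- The area of the disk around the origin which reaches to the nearest point of the
configuration. -/
noncomputable def emptyDiskArea (ψ : PointConfig) : ℝ := Real.pi * infDist 0 ψ.points ^ 2

lemma measurable_emptyDiskArea : Measurable emptyDiskArea :=
  (PointConfig.measurable_infDist.pow_const 2).const_mul _

lemma emptyDiskArea_nonneg (ψ : PointConfig) : 0 ≤ emptyDiskArea ψ := by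
  unfold emptyDiskArea
  positivity

lemma lt_emptyDiskArea_iff (ψ : PointConfig) {u : ℝ} (hu : 0 ≤ u) :
    u < emptyDiskArea ψ ↔
      ψ.points.Nonempty ∧ ψ.points ∩ closedBall 0 (√(u / Real.pi)) = ∅ := by
  rw [← ψ.lt_infDist_iff (Real.sqrt_nonneg _), Real.sqrt_lt (by positivity) infDist_nonneg,
    div_lt_iff₀' Real.pi_pos, emptyDiskArea]

lemma IsPoissonProcess.measure_lt_emptyDiskArea (hΨ : IsPoissonProcess P Ψ lam) (hlam : 0 < lam)
    {u : ℝ} (hu : 0 ≤ u) :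
    P {ω | u < emptyDiskArea (Ψ ω)} = ENNReal.ofReal (Real.exp (-(lam * u))) := by
  have h := hΨ.measure_inter_eq_empty (B := closedBall 0 √(u / Real.pi)) measurableSet_closedBall
    isBounded_closedBall
  rw [volume_closedBall_toReal (Real.sqrt_nonneg _), Real.sq_sqrt (by positivity),
    mul_div_cancel₀ _ Real.pi_pos.ne'] at h
  rw [← h]
  refine measure_congr ?_
  filter_upwards [hΨ.ae_nonempty hlam] with ω hω
  refine propext ?_
  change u < emptyDiskArea (Ψ ω) ↔ (Ψ ω).points ∩ closedBall 0 (√(u / Real.pi)) = ∅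
  rw [lt_emptyDiskArea_iff _ hu, and_iff_right hω]

lemma IsPoissonProcess.map_emptyDiskArea [IsProbabilityMeasure P] (hΨ : IsPoissonProcess P Ψ lam)
    (hlam : 0 < lam) : P.map (fun ω => emptyDiskArea (Ψ ω)) = expMeasure lam := by
  have hl : (0 : ℝ) < lam := hlam
  have hm : Measurable fun ω => emptyDiskArea (Ψ ω) :=
    measurable_emptyDiskArea.comp hΨ.measurable
  have := Measure.isProbabilityMeasure_map (μ := P) hm.aemeasurable
  have := isProbabilityMeasure_expMeasure hl
  refine Measure.eq_of_cdf _ _ (StieltjesFunction.ext fun u => ?_)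
  rw [cdf_expMeasure_eq hl, cdf_eq_real, map_measureReal_apply hm measurableSet_Iic]
  split_ifs with hu
  · have hc : (fun ω => emptyDiskArea (Ψ ω)) ⁻¹' Iic u = {ω | u < emptyDiskArea (Ψ ω)}ᶜ := by
      ext ω
      simp
    rw [hc, probReal_compl_eq_one_sub (measurableSet_lt measurable_const hm), measureReal_def,
      hΨ.measure_lt_emptyDiskArea hlam hu, ENNReal.toReal_ofReal (Real.exp_pos _).le]
  · have hc : (fun ω => emptyDiskArea (Ψ ω)) ⁻¹' Iic u = ∅ := by
      ext ω
      simpa using (not_le.1 hu).trans_le (emptyDiskArea_nonneg _)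
    simp [hc]

lemma IsPoissonProcess.lintegral_poissonCDF_emptyDiskArea [IsProbabilityMeasure P]
    (hΨ : IsPoissonProcess P Ψ lam) (hlam : 0 < lam) {c : ℝ} (hc : 0 < c) (n : ℕ) :
    ∫⁻ ω, ENNReal.ofReal (poissonCDF n (c * emptyDiskArea (Ψ ω))) ∂P =
      ENNReal.ofReal (1 - (c / (c + lam)) ^ (n + 1)) := by
  have hm : Measurable fun ω => emptyDiskArea (Ψ ω) :=
    measurable_emptyDiskArea.comp hΨ.measurable
  rw [← lintegral_expMeasure_poissonCDF hc (NNReal.coe_pos.2 hlam) n,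
    ← hΨ.map_emptyDiskArea hlam, lintegral_map _ hm]
  exact ((measurable_poissonCDF n).comp (measurable_const_mul c)).ennreal_ofReal

lemma IsPoissonProcess.ae_emptyDiskArea_pos [IsProbabilityMeasure P]
    (hΨ : IsPoissonProcess P Ψ lam) (hlam : 0 < lam) : ∀ᵐ ω ∂P, 0 < emptyDiskArea (Ψ ω) := by
  have h := hΨ.measure_lt_emptyDiskArea hlam le_rfl
  rw [mul_zero, neg_zero, Real.exp_zero, ENNReal.ofReal_one] at h
  exact (prob_compl_eq_zero_iff₀ (measurableSet_lt measurable_const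
    (measurable_emptyDiskArea.comp hΨ.measurable)).nullMeasurableSet).2 h

/-! ### Configurations for which the upper bound for the area is strict -/

/-- The configurations that have no points in the disk of radius `9 / 10` around the origin but
points near two antipodal points of the unit circle. -/
def antipodalConfigs : Set PointConfig :=
  {ψ | ψ.points ∩ ball 0 (9 / 10) = ∅ ∧
    ψ.points ∩ ball (EuclideanSpace.single 0 1) (1 / 10) ≠ ∅ ∧
    ψ.points ∩ ball (-EuclideanSpace.single 0 1) (1 / 10) ≠ ∅}

lemma IsPoissonProcess.measure_inter_ne_empty_pos [IsProbabilityMeasure P]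
    (hΨ : IsPoissonProcess P Ψ lam) (hlam : 0 < lam) (c : Plane) {r : ℝ} (hr : 0 < r) :
    P {ω | (Ψ ω).points ∩ ball c r ≠ ∅} ≠ 0 := by
  intro h
  have hm : MeasurableSet {ω | (Ψ ω).points ∩ ball c r = ∅} :=
    hΨ.measurable (PointConfig.measurableSet_inter_eq_empty measurableSet_ball isBounded_ball)
  have h' := (prob_compl_eq_zero_iff hm).1 h
  rw [hΨ.measure_inter_eq_empty measurableSet_ball isBounded_ball,
    ENNReal.ofReal_eq_one, Real.exp_eq_one_iff, neg_eq_zero] at h'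
  have hv : 0 < (volume (ball c r)).toReal :=
    ENNReal.toReal_pos (measure_ball_pos volume c hr).ne' measure_ball_lt_top.ne
  have hl : (0 : ℝ) < lam := hlam
  exact (mul_pos hl hv).ne' h'

/-- The three balls are disjoint, so the three conditions are independent, and each has positive
probability. -/
lemma IsPoissonProcess.measure_antipodalConfigs_pos [IsProbabilityMeasure P]
    (hΨ : IsPoissonProcess P Ψ lam) (hlam : 0 < lam) : P (Ψ ⁻¹' antipodalConfigs) ≠ 0 := by
  set e : Plane := EuclideanSpace.single 0 1
  have he : ‖e‖ = 1 := by simp [e]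
  let B : Fin 3 → Set Plane := ![ball 0 (9 / 10), ball e (1 / 10), ball (-e) (1 / 10)]
  have hB : ∀ i, MeasurableSet (B i) := by
    intro i
    fin_cases i <;> exact measurableSet_ball
  have hb : ∀ i, Bornology.IsBounded (B i) := by
    intro i
    fin_cases i <;> exact isBounded_ball
  have h01 : Disjoint (B 0) (B 1) := ball_disjoint_ball (by rw [dist_zero_left, he]; norm_num)
  have h02 : Disjoint (B 0) (B 2) :=
    ball_disjoint_ball (by rw [dist_zero_left, norm_neg, he]; norm_num)
  have h12 : Disjoint (B 1) (B 2) := ball_disjoint_ball (by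
    rw [dist_eq_norm, sub_neg_eq_add, ← two_smul ℝ e, norm_smul, he]
    norm_num)
  have hd : Pairwise fun i j => Disjoint (B i) (B j) := by
    intro i j hij
    fin_cases i <;> fin_cases j <;> first
      | exact absurd rfl hij | exact h01 | exact h02 | exact h12
      | exact h01.symm | exact h02.symm | exact h12.symm
  let S : Fin 3 → Set ℕ := ![{0}, {0}ᶜ, {0}ᶜ]
  have hind := (hΨ.indep_count 3 B hB hb hd).measure_inter_preimage_eq_mul Finset.univ
    (sets := S) fun i _ => MeasurableSet.of_discrete
  have hset : Ψ ⁻¹' antipodalConfigs =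
      ⋂ i ∈ Finset.univ, (fun ω => (Ψ ω).count (B i)) ⁻¹' S i := by
    ext ω
    simp only [antipodalConfigs, mem_preimage, mem_ofPred_eq, Finset.mem_univ, iInter_true,
      mem_iInter, Fin.forall_fin_succ, IsEmpty.forall_iff, and_true]
    simp only [S, B, Matrix.cons_val_zero, Matrix.cons_val_succ, mem_singleton_iff,
      mem_compl_iff, PointConfig.count_eq_zero_iff isBounded_ball, e, ne_eq]
  rw [hset, hind, Finset.prod_ne_zero_iff]
  have h0 : P ((fun ω => (Ψ ω).count (B 0)) ⁻¹' S 0) ≠ 0 := by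
    have h := hΨ.measure_inter_eq_empty (hB 0) (hb 0)
    simp_rw [← PointConfig.count_eq_zero_iff (hb 0)] at h
    exact h ▸ (ENNReal.ofReal_pos.2 (Real.exp_pos _)).ne'
  have haux : ∀ c : Plane,
      P ((fun ω => (Ψ ω).count (ball c (1 / 10))) ⁻¹' ({0}ᶜ : Set ℕ)) ≠ 0 := by
    intro c
    have h := hΨ.measure_inter_ne_empty_pos hlam c (r := 1 / 10) (by norm_num)
    simp_rw [ne_eq, ← PointConfig.count_eq_zero_iff (isBounded_ball (x := c))] at h
    exact h
  intro i _
  fin_cases i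
  · exact h0
  · exact haux e
  · exact haux (-e)

end PoissonProcess

/-! ### The conditional distribution of the degree given the eavesdroppers -/

lemma PointConfig.exists_norm_sq_eq_emptyDiskArea {ψ : PointConfig} (h : 0 < emptyDiskArea ψ) :
    ∃ y ∈ ψ.points, 0 < ‖y‖ ∧ emptyDiskArea ψ = Real.pi * ‖y‖ ^ 2 ∧ ∀ z ∈ ψ.points, ‖y‖ ≤ ‖z‖ := by
  obtain ⟨y, hy, hyd, hmin⟩ :=
    ψ.exists_norm_eq_infDist ((lt_emptyDiskArea_iff ψ le_rfl).1 h).1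
  have he : emptyDiskArea ψ = Real.pi * ‖y‖ ^ 2 := by rw [emptyDiskArea, hyd]
  refine ⟨y, hy, ?_, he, hmin⟩
  by_contra! hle
  simp [he, le_antisymm hle (norm_nonneg y)] at h

lemma volume_secureRegion_ne_top {ψ : Set Plane} (h : ψ.Nonempty) :
    volume (secureRegion ψ) ≠ ∞ := by
  obtain ⟨y, hy⟩ := h
  exact ((measure_mono (secureRegion_subset_ball hy)).trans_lt measure_ball_lt_top).ne

lemma quarter_emptyDiskArea_lt {ψ : PointConfig} (h : 0 < emptyDiskArea ψ) :
    1 / 4 * emptyDiskArea ψ < (volume (secureRegion ψ.points)).toReal := by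
  obtain ⟨y, hy, hy0, he, hmin⟩ := PointConfig.exists_norm_sq_eq_emptyDiskArea h
  have hlt := volume_ball_lt_volume_secureRegion ψ hy0 hmin
  rw [EuclideanSpace.volume_ball_fin_two, ← ENNReal.ofReal_pow (by positivity),
    ← ENNReal.ofReal_mul (by positivity),
    ENNReal.ofReal_lt_iff_lt_toReal (by positivity) (volume_secureRegion_ne_top ⟨y, hy⟩)] at hlt
  rw [he]
  linarith

lemma toReal_volume_secureRegion_le {ψ : PointConfig} (h : 0 < emptyDiskArea ψ) :
    (volume (secureRegion ψ.points)).toReal ≤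
      (2 / 3 + √3 / (4 * Real.pi)) * emptyDiskArea ψ := by
  obtain ⟨y, hy, hy0, he, -⟩ := PointConfig.exists_norm_sq_eq_emptyDiskArea h
  rw [he]
  exact ENNReal.toReal_le_of_le_ofReal (by positivity)
    (volume_secureRegion_le hy (norm_pos_iff.1 hy0))

lemma toReal_volume_secureRegion_lt {ψ : PointConfig} (h : 0 < emptyDiskArea ψ)
    (hψ : ψ ∈ antipodalConfigs) :
    (volume (secureRegion ψ.points)).toReal <
      (2 / 3 + √3 / (4 * Real.pi)) * emptyDiskArea ψ := by
  obtain ⟨y, hy, hy0, he, -⟩ := PointConfig.exists_norm_sq_eq_emptyDiskArea h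
  obtain ⟨h0, h1, h2⟩ := hψ
  obtain ⟨z₁, hz₁, h1⟩ := Set.nonempty_iff_ne_empty.2 h1
  obtain ⟨z₂, hz₂, h2⟩ := Set.nonempty_iff_ne_empty.2 h2
  rw [he, ← ENNReal.lt_ofReal_iff_toReal_lt (volume_secureRegion_ne_top ⟨y, hy⟩)]
  refine volume_secureRegion_lt_of_antipodal (by simp) (fun z hz => ?_) hy hz₁ h1 hz₂ h2
  by_contra! hlt
  exact notMem_empty z (h0 ▸ ⟨hz, by simpa using hlt⟩)

section PoissonProcess

variable {Ω : Type*} [MeasurableSpace Ω] {P : Measure Ω} {Φ Ψ : Ω → PointConfig} {lam : ℝ≥0}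

lemma IsPoissonProcess.map_basicDegreeOrigin_le (hΦ : IsPoissonProcess P Φ 1) {ψ : PointConfig}
    (hψ : ψ.points.Nonempty) (n : ℕ) :
    (P.map Φ) {φ | basicDegreeOrigin ∞ φ.points ψ.points ≤ n} =
      ENNReal.ofReal (poissonCDF n (volume (secureRegion ψ.points)).toReal) := by
  obtain ⟨y, hy⟩ := hψ
  have hb : Bornology.IsBounded (secureRegion ψ.points) :=
    isBounded_ball.subset (secureRegion_subset_ball hy)
  have h := hΦ.map_count_le (isOpen_secureRegion ψ).measurableSet hb n
  rw [NNReal.coe_one, one_mul] at h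
  rw [← h]
  congr 1
  ext φ
  simp only [mem_ofPred_eq]
  rw [basicDegreeOrigin_top, ← (φ.finite_inter _ hb).cast_ncard_eq, PointConfig.count,
    Nat.cast_le]

/-- Independence makes the joint law a product, so Tonelli allows averaging over `Φ` with `Ψ`
frozen. -/
lemma measure_basicDegreeOrigin_le_eq_lintegral [IsProbabilityMeasure P] (hΦ : Measurable Φ)
    (hΨ : Measurable Ψ) (hindep : IndepFun Φ Ψ P) (n : ℕ) :
    P {ω | basicDegreeOrigin ∞ (Φ ω).points (Ψ ω).points ≤ n} =
      ∫⁻ ω, (P.map Φ) {φ | basicDegreeOrigin ∞ φ.points (Ψ ω).points ≤ n} ∂P := by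
  have hS : MeasurableSet {p : PointConfig × PointConfig |
      basicDegreeOrigin ∞ p.1.points p.2.points ≤ n} :=
    measurable_basicDegreeOrigin (MeasurableSet.of_discrete (s := Iic (n : ℕ∞)))
  have h1 := Measure.isProbabilityMeasure_map (μ := P) hΦ.aemeasurable
  have h2 := Measure.isProbabilityMeasure_map (μ := P) hΨ.aemeasurable
  have hprod := (indepFun_iff_map_prod_eq_prod_map_map hΦ.aemeasurable hΨ.aemeasurable).1 hindep
  have hmap := Measure.map_apply (μ := P) (hΦ.prodMk hΨ) hS
  rw [hprod, Measure.prod_apply_symm hS,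
    lintegral_map (measurable_measure_prodMk_right hS) hΨ] at hmap
  exact hmap.symm

lemma measure_basicDegreeOrigin_le_bounds [IsProbabilityMeasure P] (hlam : 0 < lam)
    (hΦ : IsPoissonProcess P Φ 1) (hΨ : IsPoissonProcess P Ψ lam) (hindep : IndepFun Φ Ψ P)
    (n : ℕ) :
    ENNReal.ofReal (1 - ((2 / 3 + √3 / (4 * Real.pi)) /
        ((2 / 3 + √3 / (4 * Real.pi)) + lam)) ^ (n + 1)) <
      P {ω | basicDegreeOrigin ∞ (Φ ω).points (Ψ ω).points ≤ n} ∧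
    P {ω | basicDegreeOrigin ∞ (Φ ω).points (Ψ ω).points ≤ n} <
      ENNReal.ofReal (1 - (1 / 4 / (1 / 4 + lam)) ^ (n + 1)) := by
  have ha : 0 < 2 / 3 + √3 / (4 * Real.pi) := by positivity
  have hA : Measurable fun ω => emptyDiskArea (Ψ ω) :=
    measurable_emptyDiskArea.comp hΨ.measurable
  have hcond : ∀ᵐ ω ∂P, 0 < emptyDiskArea (Ψ ω) ∧
      (P.map Φ) {φ | basicDegreeOrigin ∞ φ.points (Ψ ω).points ≤ n} =
        ENNReal.ofReal (poissonCDF n (volume (secureRegion (Ψ ω).points)).toReal) := by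
    filter_upwards [hΨ.ae_emptyDiskArea_pos hlam] with ω hω
    exact ⟨hω, hΦ.map_basicDegreeOrigin_le ((lt_emptyDiskArea_iff _ le_rfl).1 hω).1 n⟩
  have hmeas : ∀ c : ℝ,
      Measurable fun ω => ENNReal.ofReal (poissonCDF n (c * emptyDiskArea (Ψ ω))) :=
    fun c => ((measurable_poissonCDF n).comp (hA.const_mul c)).ennreal_ofReal
  have hG := measure_basicDegreeOrigin_le_eq_lintegral hΦ.measurable hΨ.measurable hindep n
  have hGfin : ∫⁻ ω, (P.map Φ) {φ | basicDegreeOrigin ∞ φ.points (Ψ ω).points ≤ n} ∂P ≠ ∞ :=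
    hG ▸ measure_ne_top _ _
  have hS : MeasurableSet {p : PointConfig × PointConfig |
      basicDegreeOrigin ∞ p.1.points p.2.points ≤ n} :=
    measurable_basicDegreeOrigin (MeasurableSet.of_discrete (s := Iic (n : ℕ∞)))
  have h1 := Measure.isProbabilityMeasure_map (μ := P) hΦ.measurable.aemeasurable
  have hGmeas : Measurable fun ω =>
      (P.map Φ) {φ | basicDegreeOrigin ∞ φ.points (Ψ ω).points ≤ n} :=
    (measurable_measure_prodMk_right hS).comp hΨ.measurable
  rw [hG, ← hΨ.lintegral_poissonCDF_emptyDiskArea hlam ha,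
    ← hΨ.lintegral_poissonCDF_emptyDiskArea hlam (by norm_num : (0 : ℝ) < 1 / 4)]
  constructor
  -- The integrands are ordered almost everywhere, and strictly on `antipodalConfigs`, which is not
  -- null.
  · refine lintegral_strict_mono_of_ae_le_of_ae_lt_on hGmeas.aemeasurable ?_ ?_
      (hΨ.measure_antipodalConfigs_pos hlam) ?_
    · rw [hΨ.lintegral_poissonCDF_emptyDiskArea hlam ha]
      exact ENNReal.ofReal_ne_top
    · filter_upwards [hcond] with ω hω
      rw [hω.2]
      exact ENNReal.ofReal_le_ofReal ((strictAntiOn_poissonCDF n).antitoneOn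
        ENNReal.toReal_nonneg (mul_pos ha hω.1).le (toReal_volume_secureRegion_le hω.1))
    · filter_upwards [hcond] with ω hω hψ
      rw [hω.2]
      exact (ENNReal.ofReal_lt_ofReal_iff (poissonCDF_pos n ENNReal.toReal_nonneg)).2
        (strictAntiOn_poissonCDF n ENNReal.toReal_nonneg (mul_pos ha hω.1).le
          (toReal_volume_secureRegion_lt hω.1 hψ))
  · have hlt : ∀ᵐ ω ∂P, (P.map Φ) {φ | basicDegreeOrigin ∞ φ.points (Ψ ω).points ≤ n} <
        ENNReal.ofReal (poissonCDF n (1 / 4 * emptyDiskArea (Ψ ω))) := by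
      filter_upwards [hcond] with ω hω
      have h0 : 0 ≤ 1 / 4 * emptyDiskArea (Ψ ω) := by linarith [hω.1]
      rw [hω.2]
      exact (ENNReal.ofReal_lt_ofReal_iff (poissonCDF_pos n h0)).2
        (strictAntiOn_poissonCDF n h0 ENNReal.toReal_nonneg (quarter_emptyDiskArea_lt hω.1))
    exact lintegral_strict_mono_of_ae_le_of_ae_lt_on (s := univ) (hmeas _).aemeasurable hGfin
      (hlt.mono fun _ h => h.le) (by simp) (hlt.mono fun _ h _ => h)

end PoissonProcess

/-! ### The mean degree -/

/-- `N` is the number of naturals below it, also for `N = ∞`; integrated, this is the tail sum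
formula for the mean. -/
lemma ENat.toENNReal_eq_tsum (N : ℕ∞) :
    (N : ℝ≥0∞) = ∑' n : ℕ, {n : ℕ | (n : ℕ∞) < N}.indicator 1 n := by
  have h : {n : ℕ | (n : ℕ∞) < N}.encard = N := by
    induction N using ENat.recTopCoe with
    | top => simp
    | coe m =>
      have : {n : ℕ | (n : ℕ∞) < (m : ℕ∞)} = ((Finset.range m : Finset ℕ) : Set ℕ) := by
        ext n
        simp
      rw [this, Set.encard_coe_eq_coe_finsetCard, Finset.card_range]
  rw [← tsum_subtype, Pi.one_def, ENNReal.tsum_set_one, h]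

lemma lintegral_toENNReal_eq_tsum {Ω : Type*} [MeasurableSpace Ω] {P : Measure Ω} {N : Ω → ℕ∞}
    (hN : Measurable N) : ∫⁻ ω, (N ω : ℝ≥0∞) ∂P = ∑' n : ℕ, P {ω | (n : ℕ∞) < N ω} := by
  have hm : ∀ n : ℕ, MeasurableSet {ω | (n : ℕ∞) < N ω} := fun n =>
    hN (MeasurableSet.of_discrete (s := Ioi (n : ℕ∞)))
  have h : ∀ ω, (N ω : ℝ≥0∞) = ∑' n : ℕ, {ω | (n : ℕ∞) < N ω}.indicator 1 ω := fun ω => by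
    rw [ENat.toENNReal_eq_tsum]
    rfl
  simp_rw [h]
  rw [lintegral_tsum fun n => (measurable_one.indicator (hm n)).aemeasurable]
  simp_rw [lintegral_indicator_one (hm _)]

lemma tsum_ofReal_geometric {c r : ℝ} (hc : 0 < c) (hr : 0 < r) :
    ∑' n : ℕ, ENNReal.ofReal ((c / (c + r)) ^ (n + 1)) = ENNReal.ofReal (c / r) := by
  have h0 : 0 ≤ c / (c + r) := by positivity
  have h1 : c / (c + r) < 1 := by rw [div_lt_one (by positivity)]; linarith
  have hs := (hasSum_geometric_of_lt_one h0 h1).mul_left (c / (c + r))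
  simp_rw [← pow_succ'] at hs
  rw [← ENNReal.ofReal_tsum_of_nonneg (fun n => by positivity) hs.summable, hs.tsum_eq]
  congr 1
  have : 1 - c / (c + r) = r / (c + r) := by field_simp; ring
  rw [this]
  field_simp

theorem mainTheorem9 {Ω : Type*} [MeasurableSpace Ω] (P : Measure Ω) [IsProbabilityMeasure P]
    (Φ Ψ : Ω → PointConfig) (lam : ℝ≥0) (hlam : 0 < lam)
    (hΦ : IsPoissonProcess P Φ 1) (hΨ : IsPoissonProcess P Ψ lam) (hindep : IndepFun Φ Ψ P)
    (N : Ω → ℕ∞) (hN : ∀ ω, N ω = basicDegreeOrigin ∞ (Φ ω).points (Ψ ω).points)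
    (a b : ℝ) (ha : a = 2 / 3 + √3 / (4 * Real.pi)) (hb : b = 1 / 4) :
    Measurable N ∧
    (∀ n : ℕ,
      1 - (a / (a + lam)) ^ (n + 1) < P.real {ω | N ω ≤ (n : ℕ∞)} ∧
      P.real {ω | N ω ≤ (n : ℕ∞)} < 1 - (b / (b + lam)) ^ (n + 1)) ∧
    ENNReal.ofReal (b / lam) < ∫⁻ ω, (N ω : ℝ≥0∞) ∂P ∧
    ∫⁻ ω, (N ω : ℝ≥0∞) ∂P < ENNReal.ofReal (a / lam) := by
  have hl : (0 : ℝ) < lam := hlam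
  have ha0 : 0 < a := by rw [ha]; positivity
  have hb0 : 0 < b := by rw [hb]; norm_num
  have hmeas : Measurable N := by
    rw [funext hN]
    exact measurable_basicDegreeOrigin.comp (hΦ.measurable.prodMk hΨ.measurable)
  have hdist : ∀ n : ℕ,
      1 - (a / (a + lam)) ^ (n + 1) < P.real {ω | N ω ≤ (n : ℕ∞)} ∧
      P.real {ω | N ω ≤ (n : ℕ∞)} < 1 - (b / (b + lam)) ^ (n + 1) := by
    intro n
    obtain ⟨h1, h2⟩ := measure_basicDegreeOrigin_le_bounds hlam hΦ hΨ hindep n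
    simp_rw [← hN] at h1 h2
    rw [← ha, ← ofReal_measureReal] at h1
    rw [← hb, ← ofReal_measureReal] at h2
    exact ⟨(ENNReal.ofReal_lt_ofReal_iff'.1 h1).1, (ENNReal.ofReal_lt_ofReal_iff'.1 h2).1⟩
  have htail : ∀ n : ℕ,
      ENNReal.ofReal ((b / (b + lam)) ^ (n + 1)) < P {ω | (n : ℕ∞) < N ω} ∧
      P {ω | (n : ℕ∞) < N ω} < ENNReal.ofReal ((a / (a + lam)) ^ (n + 1)) := by
    intro n
    obtain ⟨h1, h2⟩ := hdist n
    have hc : {ω | (n : ℕ∞) < N ω} = {ω | N ω ≤ (n : ℕ∞)}ᶜ := by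
      ext ω
      simp
    have hr : P.real {ω | (n : ℕ∞) < N ω} = 1 - P.real {ω | N ω ≤ (n : ℕ∞)} := by
      have hm : MeasurableSet {ω | N ω ≤ (n : ℕ∞)} :=
        hmeas (MeasurableSet.of_discrete (s := Iic (n : ℕ∞)))
      rw [hc, probReal_compl_eq_one_sub hm]
    have hbp : 0 ≤ (b / (b + lam)) ^ (n + 1) := by positivity
    rw [← ofReal_measureReal (s := {ω | (n : ℕ∞) < N ω}), hr]
    exact ⟨(ENNReal.ofReal_lt_ofReal_iff (by linarith)).2 (by linarith),
      (ENNReal.ofReal_lt_ofReal_iff (by positivity)).2 (by linarith)⟩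
  have hsum := lintegral_toENNReal_eq_tsum (P := P) hmeas
  refine ⟨hmeas, hdist, ?_, ?_⟩
  · rw [hsum, ← tsum_ofReal_geometric hb0 hl]
    refine ENNReal.tsum_lt_tsum (i := 0) ?_ (fun n => (htail n).1.le) (htail 0).1
    rw [tsum_ofReal_geometric hb0 hl]
    exact ENNReal.ofReal_ne_top
  -- The weak bound comes first because the strict comparison of sums needs the smaller one to be
  -- finite.
  · have hle : ∑' n : ℕ, P {ω | (n : ℕ∞) < N ω} ≤ ENNReal.ofReal (a / lam) := by
      rw [← tsum_ofReal_geometric ha0 hl]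
      exact ENNReal.tsum_le_tsum fun n => (htail n).2.le
    rw [hsum, ← tsum_ofReal_geometric ha0 hl]
    exact ENNReal.tsum_lt_tsum (i := 0) (ne_top_of_le_ne_top ENNReal.ofReal_ne_top hle)
      (fun n => (htail n).2.le) (htail 0).2
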